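/- A branched cover is a dominant rational map $\pi\colon X\dashrightarrow Z$ over $\mathbb{C}$ between irreducible quasi-projective complex varieties of equal dimension. Its Galois group $\mathrm{Gal}(\pi)$ is the Galois group of the Galois closure of the finite extension of function fields $\mathbb{C}(X)/\mathbb{C}(Z)$ induced by $\pi$; equivalently, the Galois group over $\mathbb{C}(Z)$ of the minimal polynomial of a primitive element of this extension. For a finite group $G$, let $\mathrm{bot}(G)$ be the minimum, over all maximal chains of subgroups $G=H_0>H_1>\cdots>H_n=\mathrm{id}$, of the cost $\max_{0\le i<n}[H_i:H_{i+1}]$, where the cost of the chain of length $0$ is $1$, so that $\mathrm{bot}(\mathrm{id})=1$. The Galois width of a branched cover is $\mathrm{bot}(\pi):=\mathrm{bot}(\mathrm{Gal}(\pi))$. **Proposition.** Let $X,Y,Z$ be irreducible quasi-projective varieties over $\mathbb{C}$, and let $\pi_1\colon X\dashrightarrow Y$, $\pi_2\colon Y\dashrightarrow Z$ and $\pi\colon X\dashrightarrow Z$ be branched covers with $\pi=\pi_2\circ\pi_1$ as rational maps. Then $$\mathrm{bot}(\pi)=\max\bigl(\mathrm{bot}(\pi_1),\,\mathrm{bot}(\pi_2)\bigr).$$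 -/

import Mathlib

open CategoryTheory AlgebraicGeometry

/-! ### Galois width of a group -/

/-- A maximal chain of subgroups `G = H 0 > H 1 > ⋯ > H n = 1` of a group `G`: it starts at `G`,
ends at the trivial subgroup, and no subgroup fits strictly between two consecutive terms. -/
structure MaximalSubgroupChain (G : Type*) [Group G] where
  /-- the length `n` of the chain -/
  length : ℕ
  /-- the terms of the chain -/
  H : Fin (length + 1) → Subgroup G
  head_eq : H 0 = ⊤
  last_eq : H (Fin.last length) = ⊥
  covBy : ∀ i : Fin length, H i.succ ⋖ H i.castSucc

/-- The cost of a chain: the maximum of the indices `[H i : H (i + 1)]`. The chain of length `0`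
(which exists only for the trivial group) has cost `1`. -/
noncomputable def MaximalSubgroupChain.cost {G : Type*} [Group G]
    (c : MaximalSubgroupChain G) : ℕ :=
  max 1 (Finset.univ.sup fun i : Fin c.length => (c.H i.succ).relIndex (c.H i.castSucc))

/-- The Galois width of a finite group: the minimum cost of a maximal chain of subgroups. -/
noncomputable def groupGaloisWidth (G : Type*) [Group G] : ℕ :=
  sInf (Set.range (MaximalSubgroupChain.cost (G := G)))

/-! ### Galois group of a field extension -/

/-- The Galois group of the Galois closure of the field extension `L / K` given by a field
homomorphism `φ : K →+* L`; the Galois closure is formed inside an algebraic closure of `L`. -/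
def GaloisClosureGroup {K L : Type*} [Field K] [Field L] (φ : K →+* L) : Type _ :=
  letI : Algebra K L := φ.toAlgebra
  Gal(IntermediateField.normalClosure K L (AlgebraicClosure L)/K)

noncomputable instance {K L : Type*} [Field K] [Field L] (φ : K →+* L) :
    Group (GaloisClosureGroup φ) :=
  letI : Algebra K L := φ.toAlgebra
  inferInstanceAs (Group Gal(IntermediateField.normalClosure K L (AlgebraicClosure L)/K))

/-- If `L = K(x)`, the Galois closure of `L / K` is generated by the conjugates of `x`. -/
theorem normalClosure_eq_adjoin_rootSet {K L M : Type*} [Field K] [Field L] [Field M]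
    [Algebra K L] [Algebra K M] [IsAlgClosed M]
    {x : L} (hx : IsIntegral K x) (hgen : IntermediateField.adjoin K {x} = ⊤) :
    IntermediateField.normalClosure K L M =
      IntermediateField.adjoin K ((minpoly K x).rootSet M) := by
  have hal : Algebra.IsAlgebraic K L := by
    have := IntermediateField.isAlgebraic_adjoin_simple hx
    rw [hgen] at this
    exact (IntermediateField.topEquiv (F := K) (E := L)).isAlgebraic
  apply le_antisymm
  · refine iSup_le fun f => ?_
    rw [AlgHom.fieldRange_eq_map, ← hgen, IntermediateField.adjoin_map, Set.image_singleton]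
    refine IntermediateField.adjoin.mono _ _ _ ?_
    rw [Set.singleton_subset_iff, Polynomial.mem_rootSet_of_ne (minpoly.ne_zero hx),
      Polynomial.aeval_algHom_apply, minpoly.aeval, map_zero]
  · rw [Algebra.IsAlgebraic.normalClosure_eq_iSup_adjoin_of_splits
      (fun _ => IsAlgClosed.splits _)]
    exact le_iSup (fun y : L => IntermediateField.adjoin K ((minpoly K y).rootSet M)) x

/-- If `L = K(x)`, the group above is the Galois group over `K` of the minimal polynomial of the
primitive element `x`. -/
theorem GaloisClosureGroup.nonempty_mulEquiv_gal {K L : Type*} [Field K] [Field L]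
    (φ : K →+* L) : letI : Algebra K L := φ.toAlgebra
    ∀ x : L, IsIntegral K x → IntermediateField.adjoin K {x} = ⊤ →
      Nonempty (GaloisClosureGroup φ ≃* (minpoly K x).Gal) := by
  let _ : Algebra K L := φ.toAlgebra
  intro x hx hgen
  have h := normalClosure_eq_adjoin_rootSet (M := AlgebraicClosure L) hx hgen
  have hs : (minpoly K x).IsSplittingField K
      (IntermediateField.normalClosure K L (AlgebraicClosure L)) := by
    rw [h]
    exact IntermediateField.adjoin_rootSet_isSplittingField (IsAlgClosed.splits _)
  exact ⟨(Polynomial.IsSplittingField.algEquiv _ (minpoly K x)).autCongr⟩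

/-! ### Complex quasi-projective varieties and branched covers -/

/-- The scheme `Spec ℂ`. -/
noncomputable abbrev SpecC : Scheme.{0} := Spec (.of ℂ)

attribute [local instance] MvPolynomial.gradedAlgebra in
/-- Complex projective space `ℙⁿ = Proj ℂ[x₀, …, xₙ]`. -/
noncomputable def ProjSpaceC (n : ℕ) : Scheme.{0} :=
  Proj (MvPolynomial.homogeneousSubmodule (Fin (n + 1)) ℂ)

attribute [local instance] MvPolynomial.gradedAlgebra in
/-- The structure morphism `ℙⁿ ⟶ Spec ℂ`. -/
noncomputable def ProjSpaceC.toSpecC (n : ℕ) : ProjSpaceC n ⟶ SpecC :=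
  Proj.toSpecZero (MvPolynomial.homogeneousSubmodule (Fin (n + 1)) ℂ) ≫
    Spec.map (CommRingCat.ofHom
      (algebraMap ℂ (MvPolynomial.homogeneousSubmodule (Fin (n + 1)) ℂ 0)))

/-- An (irreducible, reduced) quasi-projective variety over `ℂ`: an integral scheme over `ℂ` that
is isomorphic, over `ℂ`, to a locally closed subscheme of some projective space. -/
class IsQuasiProjectiveVariety (X : Scheme.{0}) [X.Over SpecC] : Prop extends IsIntegral X where
  exists_immersion : ∃ (n : ℕ) (i : X ⟶ ProjSpaceC n),
    IsImmersion i ∧ i ≫ ProjSpaceC.toSpecC n = X ↘ SpecC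

/-- A branched cover `π : X ⤏ Z`: a dominant rational map over `ℂ` between quasi-projective
varieties of equal dimension. -/
class IsBranchedCover {X Z : Scheme.{0}} [X.Over SpecC] [Z.Over SpecC]
    [IsQuasiProjectiveVariety X] [IsQuasiProjectiveVariety Z] (π : X ⤏ Z) : Prop
    extends π.IsDominant, π.IsOver SpecC where
  dim_eq : topologicalKrullDim X = topologicalKrullDim Z

/-- A dominant rational map sends the generic point to the generic point. -/
theorem fromFunctionField_closedPoint {X Z : Scheme.{0}} [IsIntegral X] [IsIntegral Z]
    (π : X ⤏ Z) [hπ : π.IsDominant] :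
    π.fromFunctionField (IsLocalRing.closedPoint X.functionField) = genericPoint Z := by
  obtain ⟨f, rfl⟩ := π.exists_rep
  have hf : IsDominant f.hom := f.isDominant_toRationalMap_iff.mp hπ
  have hη : genericPoint X ∈ f.domain :=
    (genericPoint_specializes _).mem_open f.domain.2 f.dense_domain.nonempty.choose_spec
  have : Nonempty f.domain := ⟨⟨_, hη⟩⟩
  have h1 : f.domain.fromSpecStalkOfMem _ hη (IsLocalRing.closedPoint X.functionField) =
      genericPoint f.domain := by
    apply f.domain.ι.isOpenEmbedding.injective
    refine (Scheme.Hom.comp_apply (f.domain.fromSpecStalkOfMem _ hη) f.domain.ι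
      (IsLocalRing.closedPoint X.functionField)).symm.trans ?_
    rw [Scheme.Opens.fromSpecStalkOfMem_ι, genericPoint_eq_of_isOpenImmersion]
    exact Scheme.fromSpecStalk_closedPoint
  refine (Scheme.Hom.comp_apply (f.domain.fromSpecStalkOfMem _ hη) f.hom
    (IsLocalRing.closedPoint X.functionField)).trans ?_
  rw [h1]
  refine IsGenericPoint.eq (S := Set.univ) ?_ (genericPoint_spec Z)
  have := (genericPoint_spec f.domain).image f.hom.continuous
  rwa [Set.image_univ, f.hom.denseRange.closure_range] at this

/-- The pullback of rational functions `π^* : ℂ(Z) → ℂ(X)` along a dominant rational map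
`π : X ⤏ Z`. -/
noncomputable def ratPullback {X Z : Scheme.{0}} [IsIntegral X] [IsIntegral Z]
    (π : X ⤏ Z) [π.IsDominant] : Z.functionField →+* X.functionField :=
  (Z.presheaf.stalkSpecializes
      (specializes_of_eq (fromFunctionField_closedPoint π)) ≫
    Scheme.stalkClosedPointTo π.fromFunctionField).hom

/-- The Galois (monodromy) group `Gal(π)` of a branched cover `π : X ⤏ Z`: the Galois group of the
Galois closure of the extension of function fields `ℂ(X) / ℂ(Z)`. -/
abbrev BranchedCoverGal {X Z : Scheme.{0}} [X.Over SpecC] [Z.Over SpecC]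
    [IsQuasiProjectiveVariety X] [IsQuasiProjectiveVariety Z] (π : X ⤏ Z) [IsBranchedCover π] :
    Type :=
  GaloisClosureGroup (ratPullback π)

/-- The Galois width of a branched cover: the Galois width of its Galois group. -/
noncomputable def galoisWidth {X Z : Scheme.{0}} [X.Over SpecC] [Z.Over SpecC]
    [IsQuasiProjectiveVariety X] [IsQuasiProjectiveVariety Z] (π : X ⤏ Z) [IsBranchedCover π] :
    ℕ :=
  groupGaloisWidth (BranchedCoverGal π)

/-! ### Chains of subgroups with bounded indices -/

/-! Pullback of rational functions turns `π` into a tower K = ℂ(Z) ⊆ L = ℂ(Y) ⊆ M = ℂ(X), finite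
because the dimensions agree (`ratPullback_comp`, `ratPullback_finite`). Let E be the Galois closure
of M/K, G = Gal(E/K), H = Gal(E/L). Then Gal(π₂) = G/N with N ≤ H, and Gal(π₁) = H/Q, where Q fixes
the closure of M/L in E.

Width does not grow under subgroups and quotients, which gives ≥. For ≤ (`groupGaloisWidth_eq_max`),
a chain for G/N pulls back to one from G to N. A chain for H/Q gives one from gHg⁻¹ to gQg⁻¹ for
each g; since N ≤ gHg⁻¹, intersecting it with a subgroup of N cuts that subgroup down to its part in
gQg⁻¹ without raising the bound on indices. Doing this for all g descends from N to N ∩ ⋂ gQg⁻¹,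
which is trivial because the conjugates of M generate E.

The chains so built need be neither strict nor maximal: refining a chain never increases its largest
index. -/

/-- `A` and `B` are joined by a descending chain of subgroups whose successive indices are at most
`m`. -/
def HasIndexChain {G : Type*} [Group G] (m : ℕ) : Subgroup G → Subgroup G → Prop :=
  Relation.ReflTransGen fun A B => B ≤ A ∧ B.relIndex A ≤ m

namespace HasIndexChain

variable {G G' : Type*} [Group G] [Group G'] {m : ℕ} {A B : Subgroup G}

theorem mono {n : ℕ} (hmn : m ≤ n) (h : HasIndexChain m A B) : HasIndexChain n A B :=
  Relation.ReflTransGen.mono (fun _ _ h => ⟨h.1, h.2.trans hmn⟩) _ _ h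

/-- Finiteness matters here and below: `relIndex` is 0 for infinite index, so it is monotone only
when the larger index is finite. -/
theorem map [Finite G] (f : G →* G') (h : HasIndexChain m A B) :
    HasIndexChain m (A.map f) (B.map f) := by
  refine Relation.ReflTransGen.lift (Subgroup.map f) (fun C D hCD => ?_) _ _ h
  refine ⟨Subgroup.map_mono hCD.1, le_trans ?_ hCD.2⟩
  rw [← Subgroup.relIndex_comap]
  exact Subgroup.relIndex_le_of_le_left (Subgroup.le_comap_map f D) Subgroup.index_ne_zero_of_finite

theorem comap [Finite G'] (f : G →* G') {A B : Subgroup G'} (h : HasIndexChain m A B) :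
    HasIndexChain m (A.comap f) (B.comap f) := by
  refine Relation.ReflTransGen.lift (Subgroup.comap f) (fun C D hCD => ?_) _ _ h
  refine ⟨Subgroup.comap_mono hCD.1, le_trans ?_ hCD.2⟩
  rw [Subgroup.relIndex_comap]
  exact Subgroup.relIndex_le_of_le_right (Subgroup.map_comap_le f C) Subgroup.index_ne_zero_of_finite

/-- Cosets of C ∩ Y in C ∩ X inject into cosets of Y in X. -/
theorem inf_left [Finite G] (C : Subgroup G) (h : HasIndexChain m A B) :
    HasIndexChain m (C ⊓ A) (C ⊓ B) := by
  refine Relation.ReflTransGen.lift (C ⊓ ·) (fun X Y hXY => ?_) _ _ h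
  refine ⟨inf_le_inf_left C hXY.1, le_trans ?_ hXY.2⟩
  have : (C ⊓ Y).relIndex (C ⊓ X) = Y.relIndex (C ⊓ X) := by
    rw [← Subgroup.inf_relIndex_right, ← Subgroup.inf_relIndex_right Y]
    congr 1
    ext x
    simp only [Subgroup.mem_inf]
    tauto
  rw [this]
  exact Subgroup.relIndex_le_of_le_right inf_le_right Subgroup.index_ne_zero_of_finite

end HasIndexChain

/-- A descending chain of coverings from `⊤` to `⊥` with indices at most `m` is a maximal chain of
cost at most `m`. -/
theorem MaximalSubgroupChain.exists_cost_le {G : Type*} [Group G] {m : ℕ} (hm : 1 ≤ m)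
    (h : Relation.ReflTransGen (fun A B : Subgroup G => B ⋖ A ∧ B.relIndex A ≤ m) ⊤ ⊥) :
    ∃ c : MaximalSubgroupChain G, c.cost ≤ m := by
  suffices H : ∀ B : Subgroup G,
      Relation.ReflTransGen (fun A B : Subgroup G => B ⋖ A ∧ B.relIndex A ≤ m) ⊤ B →
      ∃ (n : ℕ) (H : Fin (n + 1) → Subgroup G), H 0 = ⊤ ∧ H (Fin.last n) = B ∧
        ∀ i : Fin n, H i.succ ⋖ H i.castSucc ∧ (H i.succ).relIndex (H i.castSucc) ≤ m by
    obtain ⟨n, H, h0, h1, h2⟩ := H ⊥ h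
    exact ⟨⟨n, H, h0, h1, fun i => (h2 i).1⟩, max_le hm (Finset.sup_le fun i _ => (h2 i).2)⟩
  intro B hB
  induction hB with
  | refl => exact ⟨0, fun _ => ⊤, rfl, rfl, fun i => i.elim0⟩
  | @tail C D _ hCD ih =>
    obtain ⟨n, H, h0, h1, h2⟩ := ih
    refine ⟨n + 1, Fin.snoc H D, ?_, Fin.snoc_last .., fun i => ?_⟩
    · rw [← Fin.castSucc_zero, Fin.snoc_castSucc, h0]
    · induction i using Fin.lastCases with
      | last => rw [Fin.succ_last, Fin.snoc_last, Fin.snoc_castSucc, h1]; exact hCD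
      | cast i => rw [Fin.succ_castSucc, Fin.snoc_castSucc, Fin.snoc_castSucc]; exact h2 i

/-- Indices multiply along a chain, so every index in a refinement of B ≤ A divides [A : B]. The
refinement peels off a maximal proper subgroup of A containing B. -/
theorem reflTransGen_covBy_of_le {G : Type*} [Group G] [Finite G] {m : ℕ} {A B : Subgroup G}
    (hBA : B ≤ A) (hm : B.relIndex A ≤ m) :
    Relation.ReflTransGen (fun A B : Subgroup G => B ⋖ A ∧ B.relIndex A ≤ m) A B := by
  induction A using WellFoundedLT.induction with
  | ind A ih =>
    obtain rfl | hlt := hBA.eq_or_lt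
    · exact .refl
    obtain ⟨C, hBC, hCA⟩ := exists_le_covBy_of_lt hlt
    have hmul := Subgroup.relIndex_mul_relIndex B C A hBC hCA.le
    have h1 : B.relIndex C ≤ B.relIndex A :=
      Nat.le_of_dvd (Nat.pos_of_ne_zero Subgroup.index_ne_zero_of_finite) ⟨_, hmul.symm⟩
    have h2 : C.relIndex A ≤ B.relIndex A :=
      Nat.le_of_dvd (Nat.pos_of_ne_zero Subgroup.index_ne_zero_of_finite) ⟨_, by rw [mul_comm, hmul]⟩
    exact .head ⟨hCA, h2.trans hm⟩ (ih C hCA.lt hBC (h1.trans hm))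

theorem MaximalSubgroupChain.hasIndexChain {G : Type*} [Group G] (c : MaximalSubgroupChain G) :
    HasIndexChain c.cost (⊤ : Subgroup G) ⊥ := by
  suffices H : ∀ i : Fin (c.length + 1), HasIndexChain c.cost (⊤ : Subgroup G) (c.H i) by
    exact c.last_eq ▸ H (Fin.last _)
  intro i
  induction i using Fin.induction with
  | zero => rw [c.head_eq]; exact .refl
  | succ i ih =>
    refine .tail ih ⟨(c.covBy i).le, le_max_of_le_right ?_⟩
    exact Finset.le_sup (f := fun i : Fin c.length => (c.H i.succ).relIndex (c.H i.castSucc))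
      (Finset.mem_univ i)

theorem HasIndexChain.exists_cost_le {G : Type*} [Group G] [Finite G] {m : ℕ} (hm : 1 ≤ m)
    (h : HasIndexChain m (⊤ : Subgroup G) ⊥) : ∃ c : MaximalSubgroupChain G, c.cost ≤ m := by
  refine MaximalSubgroupChain.exists_cost_le hm ?_
  generalize (⊥ : Subgroup G) = B at h ⊢
  induction h with
  | refl => exact .refl
  | tail _ h ih => exact ih.trans (reflTransGen_covBy_of_le h.1 h.2)

theorem groupGaloisWidth_mem {G : Type*} [Group G] [Finite G] :
    ∃ c : MaximalSubgroupChain G, c.cost = groupGaloisWidth G := by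
  -- Refining G ≥ 1 produces some maximal chain; without one the infimum would take the junk value
  -- 0.
  have h : HasIndexChain (max 1 (Nat.card G)) (⊤ : Subgroup G) ⊥ :=
    Relation.ReflTransGen.single ⟨bot_le, by simp⟩
  obtain ⟨c, -⟩ := h.exists_cost_le (le_max_left _ _)
  exact Nat.sInf_mem (s := Set.range (MaximalSubgroupChain.cost (G := G))) ⟨_, c, rfl⟩

theorem one_le_groupGaloisWidth (G : Type*) [Group G] [Finite G] : 1 ≤ groupGaloisWidth G := by
  obtain ⟨c, hc⟩ := groupGaloisWidth_mem (G := G)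
  exact hc ▸ le_max_left _ _

theorem hasIndexChain_groupGaloisWidth (G : Type*) [Group G] [Finite G] :
    HasIndexChain (groupGaloisWidth G) (⊤ : Subgroup G) ⊥ := by
  obtain ⟨c, hc⟩ := groupGaloisWidth_mem (G := G)
  exact hc ▸ c.hasIndexChain

theorem HasIndexChain.groupGaloisWidth_le {G : Type*} [Group G] [Finite G] {m : ℕ} (hm : 1 ≤ m)
    (h : HasIndexChain m (⊤ : Subgroup G) ⊥) : groupGaloisWidth G ≤ m := by
  obtain ⟨c, hc⟩ := h.exists_cost_le hm
  exact (Nat.sInf_le (s := Set.range (MaximalSubgroupChain.cost (G := G))) ⟨c, rfl⟩).trans hc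

theorem groupGaloisWidth_le_of_surjective {G G' : Type*} [Group G] [Group G'] [Finite G]
    (f : G →* G') (hf : Function.Surjective f) : groupGaloisWidth G' ≤ groupGaloisWidth G := by
  have := Finite.of_surjective f hf
  have h := (hasIndexChain_groupGaloisWidth G).map f
  rw [Subgroup.map_top_of_surjective f hf, Subgroup.map_bot] at h
  exact h.groupGaloisWidth_le (one_le_groupGaloisWidth G)

theorem groupGaloisWidth_le_of_injective {G G' : Type*} [Group G] [Group G'] [Finite G']
    (f : G →* G') (hf : Function.Injective f) : groupGaloisWidth G ≤ groupGaloisWidth G' := by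
  have := Finite.of_injective f hf
  have h := (hasIndexChain_groupGaloisWidth G').comap f
  rw [Subgroup.comap_top, MonoidHom.comap_bot, (MonoidHom.ker_eq_bot_iff f).mpr hf] at h
  exact h.groupGaloisWidth_le (one_le_groupGaloisWidth G')

theorem groupGaloisWidth_congr {G G' : Type*} [Group G] [Group G'] [Finite G] (e : G ≃* G') :
    groupGaloisWidth G = groupGaloisWidth G' :=
  have := Finite.of_equiv G e.toEquiv
  (groupGaloisWidth_le_of_injective e.toMonoidHom e.injective).antisymm
    (groupGaloisWidth_le_of_surjective e.toMonoidHom e.surjective)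

/-- Let `G₂` be a quotient of `G`, and `G₁` a quotient of a subgroup `H` of `G` that contains the
kernel of `G → G₂`. If the conjugates of the kernel of `H → G₁` intersect trivially, then the width
of `G` is the maximum of those of `G₁` and `G₂`. -/
theorem groupGaloisWidth_eq_max {G H G₁ G₂ : Type*} [Group G] [Group H] [Group G₁] [Group G₂]
    [Finite G] (i : H →* G) (hi : Function.Injective i) (f₁ : H →* G₁)
    (hf₁ : Function.Surjective f₁) (f₂ : G →* G₂) (hf₂ : Function.Surjective f₂)
    (hker : f₂.ker ≤ i.range)
    (hcore : ∀ x, (∀ g, g⁻¹ * x * g ∈ f₁.ker.map i) → x = 1) :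
    groupGaloisWidth G = max (groupGaloisWidth G₁) (groupGaloisWidth G₂) := by
  have : Finite H := Finite.of_injective i hi
  have : Finite G₁ := Finite.of_surjective f₁ hf₁
  have : Finite G₂ := Finite.of_surjective f₂ hf₂
  apply le_antisymm
  · set m := max (groupGaloisWidth G₁) (groupGaloisWidth G₂) with hm
    refine HasIndexChain.groupGaloisWidth_le (le_max_of_le_left (one_le_groupGaloisWidth G₁)) ?_
    have h2 : HasIndexChain m (⊤ : Subgroup G) f₂.ker :=
      ((hasIndexChain_groupGaloisWidth G₂).mono (le_max_right _ _)).comap f₂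
    have h1 : HasIndexChain m i.range (f₁.ker.map i) := by
      rw [MonoidHom.range_eq_map]
      exact (((hasIndexChain_groupGaloisWidth G₁).mono (le_max_left _ _)).comap f₁).map i
    have hconj (g : G) : HasIndexChain m (i.range.map (MulAut.conj g).toMonoidHom)
        ((f₁.ker.map i).map (MulAut.conj g).toMonoidHom) := h1.map _
    -- The kernel is normal, so it lies in every conjugate of H.
    have hle (g : G) : f₂.ker ≤ i.range.map (MulAut.conj g).toMonoidHom := by
      intro x hx
      refine ⟨g⁻¹ * x * g, hker ?_, by simp [mul_assoc]⟩
      simpa using (inferInstance : f₂.ker.Normal).conj_mem x hx g⁻¹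
    have key (s : Finset G) : HasIndexChain m f₂.ker
        (f₂.ker ⊓ ⨅ g ∈ s, (f₁.ker.map i).map (MulAut.conj g).toMonoidHom) := by
      classical
      induction s using Finset.induction_on with
      | empty => simp only [Finset.notMem_empty, iInf_false, iInf_top, inf_top_eq]; exact .refl
      | insert g s _ ih =>
        have := (hconj g).inf_left
          (f₂.ker ⊓ ⨅ g ∈ s, (f₁.ker.map i).map (MulAut.conj g).toMonoidHom)
        -- The current subgroup lies in gHg⁻¹, so the intersected chain starts at that subgroup
        -- itself.
        rw [inf_eq_left.mpr (inf_le_left.trans (hle g))] at this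
        rw [Finset.iInf_insert, inf_comm (Subgroup.map _ _), ← inf_assoc]
        exact ih.trans this
    have := Fintype.ofFinite G
    have h3 := h2.trans (key Finset.univ)
    refine (congrArg (HasIndexChain m ⊤) ?_).mp h3
    refine ((Subgroup.eq_bot_iff_forall _).mpr fun x hx => hcore x fun g => ?_)
    obtain ⟨y, hy, rfl⟩ := Subgroup.mem_iInf.mp (Subgroup.mem_iInf.mp hx.2 g) (Finset.mem_univ g)
    simpa [mul_assoc] using hy
  · exact max_le ((groupGaloisWidth_le_of_surjective f₁ hf₁).trans
      (groupGaloisWidth_le_of_injective i hi)) (groupGaloisWidth_le_of_surjective f₂ hf₂)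

/-! ### Galois width of a tower of fields -/

section GaloisTower

variable {K L M E : Type*} [Field K] [Field L] [Field M] [Field E]

/-- In a normal extension `E / K` containing `L`, the Galois closure of `L / K` inside `E` has the
same automorphism group as the one inside an algebraic closure of `L`. -/
theorem nonempty_mulEquiv_gal_normalClosure [Algebra K L] [Algebra.IsAlgebraic K L] [Algebra K E]
    [Algebra L E] [IsScalarTower K L E] [Normal K E] :
    Nonempty (Gal(IntermediateField.normalClosure K L E/K) ≃*
      Gal(IntermediateField.normalClosure K L (AlgebraicClosure L)/K)) := by
  have : Nonempty (L →ₐ[K] E) := ⟨IsScalarTower.toAlgHom K L E⟩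
  have := Algebra.IsAlgebraic.isNormalClosure_normalClosure (F := K) (K := L)
    (L := AlgebraicClosure L) fun _ => IsAlgClosed.splits _
  exact ⟨(IsNormalClosure.equiv (F := K) (K := L)).autCongr⟩

/-- Restriction of scalars as a homomorphism of automorphism groups. -/
def galRestrictScalarsHom (K L E : Type*) [Field K] [Field L] [Field E] [Algebra K L] [Algebra K E]
    [Algebra L E] [IsScalarTower K L E] : Gal(E/L) →* Gal(E/K) where
  toFun σ := σ.restrictScalars K
  map_one' := rfl
  map_mul' _ _ := rfl

/-- An automorphism trivial on the closure of L/K fixes L, hence comes from Gal(E/L). If every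
conjugate g⁻¹σg fixes M, then σ fixes every g(M); these generate E by `hE`, so σ = 1. -/
theorem groupGaloisWidth_gal_tower [Algebra K L] [Algebra K M] [Algebra L M] [IsScalarTower K L M]
    [Algebra K E] [Algebra L E] [Algebra M E] [IsScalarTower K L E] [IsScalarTower K M E]
    [IsScalarTower L M E] [FiniteDimensional K E] [IsGalois K E]
    (hE : IntermediateField.normalClosure K M E = ⊤) :
    groupGaloisWidth Gal(E/K) =
      max (groupGaloisWidth Gal(IntermediateField.normalClosure L M E/L))
        (groupGaloisWidth Gal(IntermediateField.normalClosure K L E/K)) := by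
  have : IsGalois L E := IsGalois.tower_top_of_isGalois K L E
  refine groupGaloisWidth_eq_max (galRestrictScalarsHom K L E)
    (fun σ τ h => AlgEquiv.ext fun x => DFunLike.congr_fun h x)
    (AlgEquiv.restrictNormalHom (IntermediateField.normalClosure L M E))
    (AlgEquiv.restrictNormalHom_surjective E)
    (AlgEquiv.restrictNormalHom (IntermediateField.normalClosure K L E))
    (AlgEquiv.restrictNormalHom_surjective E) ?_ ?_
  · rw [IntermediateField.restrictNormalHom_ker]
    intro σ hσ
    rw [IntermediateField.mem_fixingSubgroup_iff] at hσ
    refine ⟨AlgEquiv.ofRingEquiv (f := σ.toRingEquiv) fun x => ?_, AlgEquiv.ext fun x => rfl⟩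
    exact hσ _ (AlgHom.fieldRange_le_normalClosure (IsScalarTower.toAlgHom K L E) ⟨x, rfl⟩)
  · intro σ hσ
    rw [IntermediateField.restrictNormalHom_ker] at hσ
    have hfix (f : M →ₐ[K] E) (x : M) : σ (f x) = f x := by
      -- By normality every embedding of M in E is the restriction of an automorphism g of E.
      let g : Gal(E/K) := .ofBijective (f.liftNormal E) (Algebra.IsAlgebraic.algHom_bijective _)
      have hg : g (algebraMap M E x) = f x := f.liftNormal_commutes E x
      obtain ⟨τ, hτ, h⟩ := hσ g
      have h1 : τ (algebraMap M E x) = algebraMap M E x :=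
        (IntermediateField.mem_fixingSubgroup_iff _ _).mp hτ _
          (AlgHom.fieldRange_le_normalClosure (IsScalarTower.toAlgHom L M E) ⟨x, rfl⟩)
      have h2 : τ (algebraMap M E x) = g⁻¹ (σ (g (algebraMap M E x))) :=
        DFunLike.congr_fun h (algebraMap M E x)
      rw [h1, hg] at h2
      exact (g.toEquiv.symm_apply_eq.mp h2.symm).trans hg
    have hle : IntermediateField.normalClosure K M E ≤
        IntermediateField.fixedField (Subgroup.zpowers σ) := by
      refine iSup_le fun f => ?_
      rintro _ ⟨x, rfl⟩
      rw [← IntermediateField.mem_toSubfield]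
      rintro ⟨τ, hτ⟩
      exact MulAction.mem_stabilizer_iff.mp
        (Subgroup.zpowers_le.mpr (MulAction.mem_stabilizer_iff.mpr (hfix f x) :
          σ ∈ MulAction.stabilizer Gal(E/K) (f x)) hτ)
    rw [hE, top_le_iff] at hle
    ext x
    have hx : x ∈ IntermediateField.fixedField (Subgroup.zpowers σ) := hle ▸ trivial
    exact hx ⟨σ, Subgroup.mem_zpowers σ⟩

/-- The Galois width of a tower of finite extensions of characteristic zero. -/
theorem groupGaloisWidth_galoisClosureGroup_comp (φ : K →+* L) (ψ : L →+* M) [CharZero K]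
    (hφ : φ.Finite) (hψ : ψ.Finite) :
    groupGaloisWidth (GaloisClosureGroup (ψ.comp φ)) =
      max (groupGaloisWidth (GaloisClosureGroup ψ)) (groupGaloisWidth (GaloisClosureGroup φ)) := by
  algebraize [φ, ψ, ψ.comp φ]
  have : FiniteDimensional K L := hφ
  have : FiniteDimensional L M := hψ
  have : FiniteDimensional K M := FiniteDimensional.trans K L M
  let E := IntermediateField.normalClosure K M (AlgebraicClosure M)
  have := Algebra.IsAlgebraic.isNormalClosure_normalClosure (F := K) (K := M)
    (L := AlgebraicClosure M) fun _ => IsAlgClosed.splits _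
  let : Algebra L E := ((algebraMap M E).comp ψ).toAlgebra
  have : IsScalarTower L M E := .of_algebraMap_eq fun _ => rfl
  have : IsScalarTower K L E := .of_algebraMap_eq fun x => by
    rw [IsScalarTower.algebraMap_apply K M E]; rfl
  have : Normal K E := IsNormalClosure.normal (K := M)
  -- Separability is automatic in characteristic zero.
  have : IsGalois K E := {}
  have : Normal L E := Normal.tower_top_of_normal K L E
  have hE : IntermediateField.normalClosure K M E = ⊤ :=
    (Algebra.IsAlgebraic.isNormalClosure_iff.mp ‹_›).2
  have h := groupGaloisWidth_gal_tower (K := K) (L := L) hE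
  obtain ⟨e₁⟩ := nonempty_mulEquiv_gal_normalClosure (K := L) (L := M) (E := E)
  obtain ⟨e₂⟩ := nonempty_mulEquiv_gal_normalClosure (K := K) (L := L) (E := E)
  rw [groupGaloisWidth_congr e₁, groupGaloisWidth_congr e₂] at h
  exact h

end GaloisTower

/-! ### Dimension and transcendence degree -/

/-- Incomparability gives ≤; lying over and going up lift chains of primes, giving ≥. -/
theorem ringKrullDim_eq_of_isIntegral_of_injective (R S : Type*) [CommRing R] [CommRing S]
    [Algebra R S] [Algebra.IsIntegral R S] [FaithfulSMul R S] :
    ringKrullDim S = ringKrullDim R := by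
  apply le_antisymm
  · refine Order.krullDim_le_of_strictMono (PrimeSpectrum.comap (algebraMap R S)) fun p q h => ?_
    exact Ideal.IsIntegral.comap_lt_comap h
  · refine iSup_le fun l => ?_
    obtain ⟨P, hP, hP'⟩ := Ideal.nonempty_primesOver (S := S) l.head.asIdeal
    obtain ⟨L, hL, -⟩ := Ideal.exists_ltSeries_of_hasGoingUp l P
    exact hL ▸ Order.LTSeries.length_le_krullDim L

/-- Noether normalization: R is integral over a polynomial ring in s variables, and both sides equal
s. -/
theorem ringKrullDim_eq_trdeg {k R : Type*} [Field k] [CommRing R] [IsDomain R] [Algebra k R]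
    [Algebra.FiniteType k R] : ringKrullDim R = (Algebra.trdeg k R).toNat := by
  obtain ⟨s, g, hg, hint⟩ := exists_integral_inj_algHom_of_fg k R
  let : Algebra (MvPolynomial (Fin s) k) R := g.toRingHom.toAlgebra
  have : IsScalarTower k (MvPolynomial (Fin s) k) R := .of_algebraMap_eq fun x => (g.commutes x).symm
  have : Algebra.IsIntegral (MvPolynomial (Fin s) k) R := ⟨hint⟩
  have : FaithfulSMul (MvPolynomial (Fin s) k) R :=
    (faithfulSMul_iff_algebraMap_injective _ _).mpr hg
  have h := lift_trdeg_add_eq k (MvPolynomial (Fin s) k) R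
  rw [trdeg_eq_zero (R := MvPolynomial (Fin s) k)] at h
  rw [ringKrullDim_eq_of_isIntegral_of_injective (MvPolynomial (Fin s) k) R,
    MvPolynomial.ringKrullDim_of_isNoetherianRing, ringKrullDim_eq_zero_of_field,
    ← Cardinal.toNat_lift (Algebra.trdeg k R), ← h]
  simp

theorem trdeg_eq_of_isFractionRing {k R F : Type*} [Field k] [CommRing R] [IsDomain R] [Field F]
    [Algebra k R] [Algebra R F] [Algebra k F] [IsScalarTower k R F] [IsFractionRing R F] :
    (Algebra.trdeg k F).toNat = (Algebra.trdeg k R).toNat := by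
  have : Algebra.IsAlgebraic R F := IsLocalization.isAlgebraic F (nonZeroDivisors R)
  have h := lift_trdeg_add_eq k R F
  rw [trdeg_eq_zero (R := R), Cardinal.lift_zero, add_zero] at h
  rw [← Cardinal.toNat_lift, ← h, Cardinal.toNat_lift]

/-- By additivity L/K has transcendence degree 0, and an algebraic, essentially finitely generated
field extension is finite. All degrees are finite, so `toNat` loses nothing. -/
theorem finite_of_trdeg_le {k K L : Type*} [Field k] [Field K] [Field L] [Algebra k K] [Algebra k L]
    [Algebra K L] [IsScalarTower k K L] [Algebra.EssFiniteType k L]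
    (h : (Algebra.trdeg k L).toNat ≤ (Algebra.trdeg k K).toNat) : Module.Finite K L := by
  have h1 := lift_trdeg_add_eq k K L
  have h2 := Cardinal.lift_lt_aleph0.mpr (trdeg_lt_aleph0 k L)
  rw [← h1, Cardinal.add_lt_aleph0_iff] at h2
  have h3 := congrArg Cardinal.toNat h1
  rw [Cardinal.toNat_add h2.1 h2.2, Cardinal.toNat_lift, Cardinal.toNat_lift,
    Cardinal.toNat_lift] at h3
  have : Algebra.IsAlgebraic K L := by
    rw [← trdeg_eq_zero_iff, ← Cardinal.lift_eq_zero, ← Cardinal.cast_toNat_of_lt_aleph0 h2.2,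
      Cardinal.toNat_lift]
    exact_mod_cast by omega
  have : Algebra.EssFiniteType K L := .of_comp k K L
  exact Algebra.finite_of_essFiniteType_of_isAlgebraic

/-! ### Pullback of rational functions -/

section RatPullback

variable {X Y Z : Scheme.{0}} [IsIntegral X] [IsIntegral Y]

theorem SpecMap_ratPullback_fromSpecStalk [IsIntegral Z] (π : X ⤏ Z) [π.IsDominant] :
    Spec.map (CommRingCat.ofHom (ratPullback π)) ≫ Z.fromSpecStalk (genericPoint Z) =
      π.fromFunctionField := by
  have h : CommRingCat.ofHom (ratPullback π) = Z.presheaf.stalkSpecializes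
      (specializes_of_eq (fromFunctionField_closedPoint π)) ≫
        Scheme.stalkClosedPointTo π.fromFunctionField := rfl
  rw [h, Spec.map_comp, Category.assoc, Scheme.SpecMap_stalkSpecializes_fromSpecStalk]
  exact Scheme.Spec_stalkClosedPointTo_fromSpecStalk _

theorem ratPullback_eq_iff [IsIntegral Z] {π : X ⤏ Z} [π.IsDominant]
    {φ : Z.functionField →+* X.functionField} :
    ratPullback π = φ ↔ π.fromFunctionField =
      Spec.map (CommRingCat.ofHom φ) ≫ Z.fromSpecStalk (genericPoint Z) := by
  rw [← SpecMap_ratPullback_fromSpecStalk, cancel_mono, Spec.map_inj]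
  exact ⟨fun h => h ▸ rfl, fun h => congrArg CommRingCat.Hom.hom h⟩

/-- The composite is defined on the preimage of the domain of π₂, which contains the generic point
of X. There `h1` compares the inclusions of that point, and `h2` identifies its image in the domain
of π₂. -/
theorem fromFunctionField_comp (π₁ : X ⤏ Y) (π₂ : Y ⤏ Z) [π₁.IsDominant] :
    (π₁.comp π₂).fromFunctionField =
      Spec.map (CommRingCat.ofHom (ratPullback π₁)) ≫ π₂.fromFunctionField := by
  obtain ⟨f, hf⟩ := Scheme.PartialMap.toRationalMap_surjective π₁
  obtain ⟨g, rfl⟩ := Scheme.PartialMap.toRationalMap_surjective π₂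
  subst hf
  have : IsDominant f.hom := f.isDominant_toRationalMap_iff.mp ‹_›
  have hf := SpecMap_ratPullback_fromSpecStalk f.toRationalMap
  rw [Scheme.RationalMap.toRationalMap_comp]
  rw [Scheme.RationalMap.fromFunctionField_toRationalMap] at hf ⊢
  rw [Scheme.RationalMap.fromFunctionField_toRationalMap]
  have hη : genericPoint X ∈ f.domain.ι ''ᵁ f.hom ⁻¹ᵁ g.domain :=
    (genericPoint_specializes _).mem_open (f.comp g).domain.2
      (f.comp g).dense_domain.nonempty.choose_spec
  have hηf : genericPoint X ∈ f.domain :=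
    (genericPoint_specializes _).mem_open f.domain.2 f.dense_domain.nonempty.choose_spec
  have hηg : genericPoint Y ∈ g.domain :=
    (genericPoint_specializes _).mem_open g.domain.2 g.dense_domain.nonempty.choose_spec
  have h1 : (f.domain.ι ''ᵁ f.hom ⁻¹ᵁ g.domain).fromSpecStalkOfMem _ hη ≫
      (f.domain.ι.isoImage (f.hom ⁻¹ᵁ g.domain)).inv ≫ (f.hom ⁻¹ᵁ g.domain).ι =
        f.domain.fromSpecStalkOfMem _ hηf := by
    rw [← cancel_mono f.domain.ι, Scheme.Opens.fromSpecStalkOfMem_ι, Category.assoc, Category.assoc,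
      Scheme.Hom.isoImage_inv_ι, Scheme.Opens.fromSpecStalkOfMem_ι]
  have h2 : (f.domain.ι ''ᵁ f.hom ⁻¹ᵁ g.domain).fromSpecStalkOfMem _ hη ≫
      (f.domain.ι.isoImage (f.hom ⁻¹ᵁ g.domain)).inv ≫ f.hom ∣_ g.domain =
        Spec.map (CommRingCat.ofHom (ratPullback f.toRationalMap)) ≫
          g.domain.fromSpecStalkOfMem _ hηg := by
    rw [← cancel_mono g.domain.ι, Category.assoc, Category.assoc, morphismRestrict_ι,
      Category.assoc, Scheme.Opens.fromSpecStalkOfMem_ι, hf]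
    have := congr($h1 ≫ f.hom)
    simp only [Category.assoc] at this
    exact this
  have := congr($h2 ≫ g.hom)
  simp only [Category.assoc] at this
  exact this

theorem ratPullback_comp [IsIntegral Z] (π₁ : X ⤏ Y) (π₂ : Y ⤏ Z) [π₁.IsDominant] [π₂.IsDominant] :
    ratPullback (π₁.comp π₂) = (ratPullback π₁).comp (ratPullback π₂) := by
  rw [ratPullback_eq_iff, fromFunctionField_comp, CommRingCat.ofHom_comp, Spec.map_comp,
    Category.assoc, SpecMap_ratPullback_fromSpecStalk]

end RatPullback

/-! ### Constants -/

section Constants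

variable {X Z : Scheme.{0}} [X.Over SpecC] [Z.Over SpecC]

/-- The embedding of the constants into the function field of a scheme over `ℂ`. -/
noncomputable def constHom (X : Scheme.{0}) [X.Over SpecC] [IrreducibleSpace X] :
    ℂ →+* X.functionField :=
  (Spec.preimage (X.fromSpecStalk (genericPoint X) ≫ X ↘ SpecC)).hom

theorem SpecMap_constHom [IrreducibleSpace X] : Spec.map (CommRingCat.ofHom (constHom X)) =
    X.fromSpecStalk (genericPoint X) ≫ X ↘ SpecC :=
  Spec.map_preimage _

theorem fromFunctionField_comp_over [IrreducibleSpace X] (π : X ⤏ Z) [π.IsOver SpecC] :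
    π.fromFunctionField ≫ Z ↘ SpecC = X.fromSpecStalk (genericPoint X) ≫ X ↘ SpecC := by
  have h := congrArg Scheme.RationalMap.fromFunctionField
    (Scheme.RationalMap.isOver_iff.mp ‹π.IsOver SpecC›)
  obtain ⟨f, rfl⟩ := Scheme.PartialMap.toRationalMap_surjective π
  simpa [Scheme.RationalMap.fromFunctionField_toRationalMap] using! h

theorem ratPullback_comp_constHom [IsIntegral X] [IsIntegral Z] (π : X ⤏ Z) [π.IsDominant]
    [π.IsOver SpecC] : (ratPullback π).comp (constHom Z) = constHom X := by
  have : CommRingCat.ofHom ((ratPullback π).comp (constHom Z)) =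
      CommRingCat.ofHom (constHom X) := by
    rw [← Spec.map_inj, CommRingCat.ofHom_comp, Spec.map_comp, SpecMap_constHom, SpecMap_constHom,
      ← Category.assoc, SpecMap_ratPullback_fromSpecStalk, fromFunctionField_comp_over]
  exact congrArg CommRingCat.Hom.hom this

theorem exists_finiteType_comp_eq_constHom [IsIntegral X] [LocallyOfFiniteType (X ↘ SpecC)]
    {U : X.Opens} (hU : IsAffineOpen U) [Nonempty U] :
    ∃ φ : ℂ →+* Γ(X, U), φ.FiniteType ∧ (X.germToFunctionField U).hom.comp φ = constHom X := by
  let f := Spec.preimage (hU.fromSpec ≫ X ↘ SpecC)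
  have hf : Spec.map f = hU.fromSpec ≫ X ↘ SpecC := Spec.map_preimage _
  refine ⟨f.hom, ?_, ?_⟩
  · rw [← HasRingHomProperty.Spec_iff (P := @LocallyOfFiniteType), hf]
    infer_instance
  · have hη : genericPoint X ∈ U :=
      ((genericPoint_spec X).mem_open_set_iff U.isOpen).mpr (by simpa using ‹Nonempty U›)
    have : f ≫ X.germToFunctionField U = CommRingCat.ofHom (constHom X) := by
      rw [← Spec.map_inj, SpecMap_constHom, Spec.map_comp, hf,
        ← hU.fromSpecStalk_eq_fromSpecStalk hη, IsAffineOpen.fromSpecStalk, Category.assoc]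
    exact congrArg CommRingCat.Hom.hom this

end Constants
-- Dimension of a variety via its function field
section
open TopologicalSpace Topology
-- A point of the smallest member of a chain lies in all of them, so the whole chain meets an open
-- neighbourhood S of it; irreducible closed sets meeting S correspond to those of S.
theorem topologicalKrullDim_le_of_forall_exists_isOpenEmbedding {T : Type*} [TopologicalSpace T]
    {n : WithBot ℕ∞} (h : ∀ x : T, ∃ (S : Type) (_ : TopologicalSpace S) (f : S → T),
      IsOpenEmbedding f ∧ x ∈ Set.range f ∧ topologicalKrullDim S ≤ n) :
    topologicalKrullDim T ≤ n := by
  refine iSup_le fun l => ?_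
  obtain ⟨x, hx⟩ := l.head.isIrreducible.nonempty
  obtain ⟨S, _, f, hf, ⟨y, rfl⟩, hS⟩ := h x
  refine le_trans ?_ hS
  rw [topologicalKrullDim,
    Order.krullDim_eq_of_orderIso (IrreducibleCloseds.orderIsoOfIsOpenEmbedding f hf)]
  have hmem (i : Fin (l.length + 1)) : (f ⁻¹' (l i : Set T)).Nonempty :=
    ⟨y, l.head_le i hx⟩
  let l' : LTSeries {V : IrreducibleCloseds T | (f ⁻¹' V).Nonempty} :=
    { length := l.length
      toFun i := ⟨l i, hmem i⟩
      step i := l.step i }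
  exact Order.LTSeries.length_le_krullDim l'
end

attribute [local instance] MvPolynomial.gradedAlgebra in
instance (n : ℕ) : LocallyOfFiniteType (ProjSpaceC.toSpecC n) := by
  have h1 : Function.Surjective
      (algebraMap ℂ (MvPolynomial.homogeneousSubmodule (Fin (n + 1)) ℂ 0)) := by
    rintro ⟨p, hp⟩
    refine ⟨p.coeff 0, Subtype.ext ?_⟩
    -- A form of degree 0 is constant.
    have := MvPolynomial.IsHomogeneous.totalDegree_le hp
    exact (MvPolynomial.totalDegree_eq_zero_iff_eq_C.mp (Nat.le_zero.mp this)).symm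
  have h2 : LocallyOfFiniteType (Spec.map (CommRingCat.ofHom
      (algebraMap ℂ (MvPolynomial.homogeneousSubmodule (Fin (n + 1)) ℂ 0)))) := by
    rw [HasRingHomProperty.Spec_iff (P := @LocallyOfFiniteType)]
    exact RingHom.FiniteType.of_surjective _ h1
  have : IsScalarTower ℂ (MvPolynomial.homogeneousSubmodule (Fin (n + 1)) ℂ 0)
      (MvPolynomial (Fin (n + 1)) ℂ) :=
    .of_algebraMap_eq (R := ℂ) (S := MvPolynomial.homogeneousSubmodule (Fin (n + 1)) ℂ 0)
      (A := MvPolynomial (Fin (n + 1)) ℂ) fun _ => rfl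
  have : Algebra.FiniteType (MvPolynomial.homogeneousSubmodule (Fin (n + 1)) ℂ 0)
      (MvPolynomial (Fin (n + 1)) ℂ) :=
    .of_restrictScalars_finiteType ℂ _ _
  have : LocallyOfFiniteType
      (Proj.toSpecZero (MvPolynomial.homogeneousSubmodule (Fin (n + 1)) ℂ)) := inferInstance
  unfold ProjSpaceC.toSpecC
  exact MorphismProperty.comp_mem @LocallyOfFiniteType _ _ this h2

instance IsQuasiProjectiveVariety.locallyOfFiniteType (X : Scheme.{0}) [X.Over SpecC]
    [IsQuasiProjectiveVariety X] : LocallyOfFiniteType (X ↘ SpecC) := by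
  obtain ⟨n, i, hi, h⟩ := IsQuasiProjectiveVariety.exists_immersion (X := X)
  rw [← h]
  infer_instance

section Dimension

variable {X Z : Scheme.{0}} [X.Over SpecC] [Z.Over SpecC] [IsIntegral X] [IsIntegral Z]

theorem topologicalKrullDim_Spec_of_isAffineOpen [LocallyOfFiniteType (X ↘ SpecC)]
    {U : X.Opens} (hU : IsAffineOpen U) [Nonempty U] :
    letI := (constHom X).toAlgebra
    topologicalKrullDim (Spec Γ(X, U)) = (Algebra.trdeg ℂ X.functionField).toNat := by
  obtain ⟨φ, hφ, hφX⟩ := exists_finiteType_comp_eq_constHom hU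
  algebraize [φ, constHom X]
  have : IsScalarTower ℂ Γ(X, U) X.functionField := .of_algebraMap_eq' hφX.symm
  have := functionField_isFractionRing_of_isAffineOpen X U hU
  rw [trdeg_eq_of_isFractionRing (k := ℂ) (R := Γ(X, U)), ← ringKrullDim_eq_trdeg]
  exact PrimeSpectrum.topologicalKrullDim_eq_ringKrullDim Γ(X, U)

theorem exists_isAffineOpen_mem (X : Scheme.{0}) (x : X) :
    ∃ U : X.Opens, IsAffineOpen U ∧ x ∈ U := by
  obtain ⟨U, hU, hxU, -⟩ := exists_isAffineOpen_mem_and_subset (show x ∈ (⊤ : X.Opens) from trivial)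
  exact ⟨U, hU, hxU⟩

/-- Every nonempty affine open has the same function field, hence the same dimension; these opens
cover X. -/
theorem topologicalKrullDim_eq_trdeg [LocallyOfFiniteType (X ↘ SpecC)] :
    letI := (constHom X).toAlgebra
    topologicalKrullDim X = (Algebra.trdeg ℂ X.functionField).toNat := by
  apply le_antisymm
  · refine topologicalKrullDim_le_of_forall_exists_isOpenEmbedding fun x => ?_
    obtain ⟨U, hU, hxU⟩ := exists_isAffineOpen_mem X x
    have : Nonempty U := ⟨⟨x, hxU⟩⟩
    exact ⟨Spec Γ(X, U), inferInstance, hU.fromSpec, hU.fromSpec.isOpenEmbedding,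
      by rwa [hU.range_fromSpec], (topologicalKrullDim_Spec_of_isAffineOpen hU).le⟩
  · obtain ⟨U, hU, hxU⟩ := exists_isAffineOpen_mem X (genericPoint X)
    have : Nonempty U := ⟨⟨_, hxU⟩⟩
    rw [← topologicalKrullDim_Spec_of_isAffineOpen hU]
    exact hU.fromSpec.isOpenEmbedding.isInducing.topologicalKrullDim_le

theorem essFiniteType_functionField [LocallyOfFiniteType (X ↘ SpecC)] :
    letI := (constHom X).toAlgebra
    Algebra.EssFiniteType ℂ X.functionField := by
  obtain ⟨U, hU, hxU⟩ := exists_isAffineOpen_mem X (genericPoint X)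
  have : Nonempty U := ⟨⟨_, hxU⟩⟩
  obtain ⟨φ, hφ, hφX⟩ := exists_finiteType_comp_eq_constHom hU
  algebraize [φ, constHom X]
  have : IsScalarTower ℂ Γ(X, U) X.functionField := .of_algebraMap_eq' hφX.symm
  have := functionField_isFractionRing_of_isAffineOpen X U hU
  have : Algebra.EssFiniteType Γ(X, U) X.functionField :=
    .of_isLocalization _ (nonZeroDivisors Γ(X, U))
  exact .comp ℂ Γ(X, U) X.functionField

/-- A dominant rational map between varieties of equal dimension induces a finite extension of
function fields. -/
theorem ratPullback_finite [LocallyOfFiniteType (X ↘ SpecC)] [LocallyOfFiniteType (Z ↘ SpecC)]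
    (π : X ⤏ Z) [π.IsDominant] [π.IsOver SpecC]
    (h : topologicalKrullDim X = topologicalKrullDim Z) : (ratPullback π).Finite := by
  let _ := (constHom X).toAlgebra
  let _ := (constHom Z).toAlgebra
  let _ := (ratPullback π).toAlgebra
  have : IsScalarTower ℂ Z.functionField X.functionField :=
    .of_algebraMap_eq' (ratPullback_comp_constHom π).symm
  have := essFiniteType_functionField (X := X)
  rw [topologicalKrullDim_eq_trdeg, topologicalKrullDim_eq_trdeg] at h
  exact finite_of_trdeg_le (k := ℂ) (by exact_mod_cast h.le)

end Dimension

/-! ### Width of a composite of branched covers -/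

theorem IsBranchedCover.ratPullback_finite {X Z : Scheme.{0}} [X.Over SpecC] [Z.Over SpecC]
    [IsQuasiProjectiveVariety X] [IsQuasiProjectiveVariety Z] (π : X ⤏ Z) [IsBranchedCover π] :
    (ratPullback π).Finite :=
  _root_.ratPullback_finite π (IsBranchedCover.dim_eq π)

theorem proposition3p8 {X Y Z : Scheme.{0}} [X.Over SpecC] [Y.Over SpecC] [Z.Over SpecC]
    [IsQuasiProjectiveVariety X] [IsQuasiProjectiveVariety Y] [IsQuasiProjectiveVariety Z]
    (π : X ⤏ Z) (π₁ : X ⤏ Y) (π₂ : Y ⤏ Z)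
    [IsBranchedCover π] [IsBranchedCover π₁] [IsBranchedCover π₂]
    (hπ : π = π₁.comp π₂) :
    galoisWidth π = max (galoisWidth π₁) (galoisWidth π₂) := by
  subst hπ
  have : CharZero Z.functionField := charZero_of_injective_ringHom (constHom Z).injective
  change groupGaloisWidth (GaloisClosureGroup (ratPullback (π₁.comp π₂))) = _
  rw [ratPullback_comp]
  exact groupGaloisWidth_galoisClosureGroup_comp _ _ (IsBranchedCover.ratPullback_finite π₂)
    (IsBranchedCover.ratPullback_finite π₁)
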